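/- Let $X$ be a compact Hausdorff space with its uniform structure $\mathscr U_X$, and let $T$ be a semigroup (under composition) of continuous self-maps of $X$ containing $\mathrm{id}_X$, endowed with a topology such that $T$ is a topological semigroup and the evaluation $T\times X\to X$, $(t,x)\mapsto tx$, is jointly continuous (for instance the discrete topology). Assume that - $(T,X)$ is minimal: the orbit $Tx$ is dense in $X$ for every $x\in X$; - $(T,X)$ is universally transitive: there is $x\in X$ with $\mathrm{Aut}(T,X)\,x=X$, where $\mathrm{Aut}(T,X)$ is the group of all self-homeomorphisms $a$ of $X$ with $at=ta$ for all $t\in T$. Then the following three conditions are equivalent: 1. $(T,X)$ is weakly almost periodic: for every continuous $f\colon X\to\mathbb R$, the set $\{x\mapsto f(tx) : t\in T\}$ is relatively compact in $C(X,\mathbb R)$ for the topology of pointwise convergence; 2. $(T,X)$ is equicontinuous: for every $\varepsilon\in\mathscr U_X$ there is $\delta\in\mathscr U_X$ such that $(x,y)\in\delta$ implies $(tx,ty)\in\varepsilon$ for all $t\in T$; 3. $(T,X)$ is uniformly almost periodic: for every $\varepsilon\in\mathscr U_X$ there is a set $A\subseteq T$ such that $(x,tx)\in\varepsilon$ for all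 $t\in A$ and $x\in X$, and which is syndetic, i.e. there is a compact $K\subseteq T$ with $Kt\cap A\neq\emptyset$ for every $t\in T$. -/

import Mathlib

open scoped Uniformity

/-! A semiflow `(T, X)`: a topological monoid `T` acting on `X` by a jointly continuous action,
expressed by `[Monoid T] [TopologicalSpace T] [ContinuousMul T] [MulAction T X]
[ContinuousSMul T X]`. Minimality is Mathlib's `MulAction.IsMinimal T X` (all orbits dense). -/

namespace Semiflow

/-- `A ⊆ T` is syndetic: there is a compact `K ⊆ T` such that `K t` meets `A` for each `t ∈ T`. -/
def IsSyndetic {T : Type*} [Mul T] [TopologicalSpace T] (A : Set T) : Prop :=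
  ∃ K : Set T, IsCompact K ∧ ∀ t : T, ∃ k ∈ K, k * t ∈ A

/-- Uniform almost periodicity: for each entourage `ε` there is a syndetic `A ⊆ T` with
`A x ⊆ ε[x]` for all `x`. -/
def UniformlyAlmostPeriodic (T X : Type*) [Monoid T] [TopologicalSpace T] [UniformSpace X]
    [MulAction T X] : Prop :=
  ∀ ε ∈ 𝓤 X, ∃ A : Set T, IsSyndetic A ∧ ∀ t ∈ A, ∀ x : X, (x, t • x) ∈ ε

/-- Equicontinuity: for each entourage `ε` there is an entourage `δ` such that `(x, y) ∈ δ`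
implies `(t x, t y) ∈ ε` for all `t ∈ T`. -/
def Equicontinuous (T X : Type*) [Monoid T] [UniformSpace X] [MulAction T X] : Prop :=
  ∀ ε ∈ 𝓤 X, ∃ δ ∈ 𝓤 X, ∀ x y : X, (x, y) ∈ δ → ∀ t : T, (t • x, t • y) ∈ ε

/-- The continuous real functions on `X` with the topology of pointwise convergence, i.e. the
subspace topology inherited from the product `X → ℝ`. -/
abbrev Cp (X : Type*) [TopologicalSpace X] : Type _ := {g : X → ℝ // Continuous g}

/-- The translate `f_t : x ↦ f (t x)`. -/
def translate {T X : Type*} [Monoid T] [TopologicalSpace X] [MulAction T X]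
    [ContinuousConstSMul T X] (f : Cp X) (t : T) : Cp X :=
  ⟨fun x => f.1 (t • x), f.2.comp (continuous_const_smul t)⟩

/-- Weak almost periodicity: for every continuous `f : X → ℝ`, the set `T f` of translates is
relatively compact in `C(X, ℝ)` with the topology of pointwise convergence. -/
def WeaklyAlmostPeriodic (T X : Type*) [Monoid T] [TopologicalSpace X] [MulAction T X]
    [ContinuousConstSMul T X] : Prop :=
  ∀ f : Cp X, IsCompact (closure (Set.range fun t : T => translate f t))

/-- `Aut(T, X)`: the group of self-homeomorphisms of `X` commuting with every `t ∈ T`. -/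
def aut (T X : Type*) [Monoid T] [TopologicalSpace X] [MulAction T X] : Subgroup (X ≃ₜ X) where
  carrier := {a | ∀ (t : T) (x : X), a (t • x) = t • a x}
  one_mem' _ _ := rfl
  mul_mem' {a b} ha hb t x := by
    change a (b (t • x)) = t • a (b x)
    rw [hb, ha]
  inv_mem' {a} ha t x := by
    change a.symm (t • x) = t • a.symm x
    rw [Homeomorph.symm_apply_eq, ha, Homeomorph.apply_symm_apply]

/-- Universal transitivity: `Aut(T, X) x = X` for some `x ∈ X`. -/
def UniversallyTransitive (T X : Type*) [Monoid T] [TopologicalSpace X] [MulAction T X] : Prop :=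
  ∃ x : X, ∀ y : X, ∃ a ∈ aut T X, a x = y

end Semiflow

open Filter Topology

universe u

/-! Universal transitivity makes every map commuting with `aut T X` surjective: each `t`, and each
pointwise limit of such maps.

Equicontinuity and uniform almost periodicity: an equicontinuous family on a compact space is
totally bounded for uniform convergence, so by pigeonhole each `t` has a positive power uniformly
near the identity. Finitely many powers then serve as approximate inverses for all of `T`, which
gives syndeticity. Conversely, `k * t` near the identity puts `t⁻¹` near `k`; compactness of `K`
makes the inverses equicontinuous, and recurrence carries this back to `T`.

Weak almost periodicity follows from equicontinuity by Arzelà–Ascoli. For the converse, the Ellis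
semigroup is a group of continuous maps, compact in `X → X`, so `(x, p) ↦ f (p x)` is separately
continuous. A Namioka-type argument finds a nonempty open set on which it oscillates little,
uniformly in `p`; minimality and inverses in the group transport this to any point. -/

theorem exists_symm_four_comp_subset {X : Type*} [UniformSpace X] {ε : Set (X × X)}
    (hε : ε ∈ 𝓤 X) : ∃ V ∈ 𝓤 X, (∀ a b, (a, b) ∈ V → (b, a) ∈ V) ∧
      ∀ a b c d e, (a, b) ∈ V → (b, c) ∈ V → (c, d) ∈ V → (d, e) ∈ V → (a, e) ∈ ε := by
  obtain ⟨W, hW, -, hWε⟩ := comp_symm_of_uniformity hε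
  obtain ⟨V, hV, hVs, hVW⟩ := comp_symm_of_uniformity hW
  exact ⟨V, hV, fun a b h => hVs h, fun a b c d e h₁ h₂ h₃ h₄ =>
    hWε ⟨c, hVW ⟨b, h₁, h₂⟩, hVW ⟨d, h₃, h₄⟩⟩⟩

theorem compactSpace_mem_uniformity {X : Type*} [UniformSpace X] [CompactSpace X]
    {ε : Set (X × X)} (h : ∀ x, ε ∈ 𝓝 (x, x)) : ε ∈ 𝓤 X := by
  rw [compactSpace_uniformity]
  exact mem_iSup.2 h

/-- A uniformly equicontinuous family of self-maps of a compact space is totally bounded for the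
uniformity of uniform convergence. -/
theorem UniformEquicontinuous.exists_finite_coloring {X : Type u} {ι : Type*} [UniformSpace X]
    [CompactSpace X] {φ : ι → X → X} (hφ : UniformEquicontinuous φ) {ε : Set (X × X)}
    (hε : ε ∈ 𝓤 X) : ∃ (κ : Type u) (_ : Finite κ) (c : ι → κ),
      ∀ i j, c i = c j → ∀ x, (φ i x, φ j x) ∈ ε := by
  obtain ⟨V, hV, hVs, hV4⟩ := exists_symm_four_comp_subset hε
  have cover : ∀ W ∈ 𝓤 X, ∃ t : Set X, t.Finite ∧ ∀ x, ∃ y ∈ t, (x, y) ∈ W := by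
    intro W hW
    obtain ⟨t, ht, htW⟩ := (isCompact_univ (X := X)).totallyBounded W hW
    refine ⟨t, ht, fun x => ?_⟩
    simpa using htW (Set.mem_univ x)
  obtain ⟨F, hF, hFc⟩ := cover _ (hφ V hV)
  obtain ⟨G, hG, hGc⟩ := cover V hV
  choose g hg hgV using hGc
  have := hF.to_subtype
  have := hG.to_subtype
  -- The colour of `i` records `φ i` on the net `F`, rounded to the net `G`.
  refine ⟨F → G, inferInstance, fun i x => ⟨g (φ i x), hg _⟩, fun i j hij x => ?_⟩
  obtain ⟨y, hy, hxy⟩ := hFc x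
  have hgg : g (φ i y) = g (φ j y) := congrArg Subtype.val (congrFun hij ⟨y, hy⟩)
  exact hV4 _ _ _ _ _ (hxy i) (hgV _) (hgg ▸ hVs _ _ (hgV _)) (hVs _ _ (hxy j))

/-- A surjection whose iterates are uniformly equicontinuous is uniformly recurrent. -/
theorem UniformEquicontinuous.exists_iterate_succ_near_id {X ι : Type*} [UniformSpace X]
    [CompactSpace X] {φ : ι → X → X} (hφ : UniformEquicontinuous φ) {s : X → X}
    (hs : s.Surjective) (hsφ : ∀ n, ∃ i, φ i = s^[n]) {ε : Set (X × X)} (hε : ε ∈ 𝓤 X) :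
    ∃ n, ∀ x, (s^[n + 1] x, x) ∈ ε := by
  obtain ⟨κ, _, c, hc⟩ := hφ.exists_finite_coloring (symm_le_uniformity hε)
  choose i hi using hsφ
  obtain ⟨m, n, hmn, hcmn⟩ : ∃ m n, m < n ∧ c (i m) = c (i n) := by
    obtain ⟨m, n, hmn, h⟩ := Finite.exists_ne_map_eq_of_infinite fun n => c (i n)
    rcases hmn.lt_or_gt with h' | h'
    exacts [⟨m, n, h', h⟩, ⟨n, m, h', h.symm⟩]
  obtain ⟨k, rfl⟩ := Nat.exists_eq_add_of_lt hmn
  refine ⟨k, fun x => ?_⟩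
  -- Surjectivity allows the common factor `s^[m]` to be cancelled.
  obtain ⟨y, rfl⟩ := hs.iterate m x
  have := hc _ _ hcmn y
  rw [hi, hi, show m + k + 1 = (k + 1) + m by omega, Function.iterate_add_apply] at this
  exact this

/-- If `φ i` iterated `n + 1` times is near the identity, then its `n`-th iterate, a member of the
family, is near its inverse. -/
theorem UniformEquicontinuous.symm_of_iterate {X ι : Type*} [UniformSpace X] [CompactSpace X]
    {φ : ι → X ≃ X} (hφ : UniformEquicontinuous fun i => (φ i : X → X))
    (hpow : ∀ i n, ∃ j, (φ j : X → X) = (φ i)^[n]) :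
    UniformEquicontinuous fun i => ((φ i).symm : X → X) := by
  intro ε hε
  obtain ⟨V, hV, hVs, hV4⟩ := exists_symm_four_comp_subset hε
  filter_upwards [hφ V hV] with ⟨x, y⟩ hxy i
  obtain ⟨n, hn⟩ := hφ.exists_iterate_succ_near_id (φ i).surjective (hpow i) hV
  obtain ⟨j, hj⟩ := hpow i n
  have h : ∀ z, (φ j z, (φ i).symm z) ∈ V := fun z => by
    simpa [hj] using hn ((φ i).symm z)
  exact hV4 _ _ _ _ _ (hVs _ _ (h x)) (hxy j) (h y) (refl_mem_uniformity hV)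

/-! ### Equicontinuity and uniform almost periodicity -/

namespace Semiflow

theorem uniformEquicontinuous_iff {T X : Type*} [Monoid T] [UniformSpace X] [MulAction T X] :
    Equicontinuous T X ↔ UniformEquicontinuous fun (t : T) (x : X) => t • x := by
  refine ⟨fun h ε hε => ?_, fun h ε hε => ⟨_, h ε hε, fun x y hxy => hxy⟩⟩
  obtain ⟨δ, hδ, h⟩ := h ε hε
  exact mem_of_superset hδ fun p hp => h p.1 p.2 hp

theorem UniversallyTransitive.exists_aut {T X : Type*} [Monoid T] [TopologicalSpace X]
    [MulAction T X] (h : UniversallyTransitive T X) (x y : X) : ∃ a ∈ aut T X, a x = y := by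
  obtain ⟨z, hz⟩ := h
  obtain ⟨a, ha, rfl⟩ := hz x
  obtain ⟨b, hb, rfl⟩ := hz y
  exact ⟨b * a⁻¹, mul_mem hb (inv_mem ha), congrArg b (a.symm_apply_apply z)⟩

/-- The range of `p` is nonempty and invariant under the transitive group `aut T X`. -/
theorem UniversallyTransitive.surjective {T X : Type*} [Monoid T] [TopologicalSpace X]
    [MulAction T X] (h : UniversallyTransitive T X) {p : X → X}
    (hp : ∀ a ∈ aut T X, ∀ x, a (p x) = p (a x)) : p.Surjective := by
  intro y
  obtain ⟨x, -⟩ := id h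
  obtain ⟨a, ha, rfl⟩ := h.exists_aut (p x) y
  exact ⟨a x, (hp a ha x).symm⟩

theorem UniversallyTransitive.smul_surjective {T X : Type*} [Monoid T] [TopologicalSpace X]
    [MulAction T X] (h : UniversallyTransitive T X) (t : T) :
    Function.Surjective fun x : X => t • x :=
  h.surjective fun _ ha x => ha t x

theorem smul_iterate_eq {T X : Type*} [Monoid T] [MulAction T X] (t : T) (n : ℕ) :
    (fun x : X => t ^ n • x) = (fun x => t • x)^[n] :=
  (smul_iterate t n).symm

theorem Equicontinuous.uniformlyAlmostPeriodic {T X : Type*} [Monoid T] [TopologicalSpace T]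
    [UniformSpace X] [CompactSpace X] [MulAction T X] (h : Equicontinuous T X)
    (hsurj : ∀ t : T, Function.Surjective fun x : X => t • x) :
    UniformlyAlmostPeriodic T X := by
  rw [uniformEquicontinuous_iff] at h
  intro ε hε
  obtain ⟨V, hV, hVs, hV4⟩ := exists_symm_four_comp_subset hε
  have hrec : ∀ t : T, ∃ n : ℕ, ∀ x : X, (t ^ (n + 1) • x, x) ∈ V := fun t => by
    obtain ⟨n, hn⟩ := h.exists_iterate_succ_near_id (hsurj t)
      (fun n => ⟨t ^ n, smul_iterate_eq t n⟩) hV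
    exact ⟨n, fun x => by simpa only [← smul_iterate_eq] using hn x⟩
  choose n hn using hrec
  -- Colouring at the entourage of pairs whose `T`-translates all stay in `V` keeps same-coloured
  -- elements close after applying `s ^ n s` on the left.
  obtain ⟨κ, _, c, hc⟩ := h.exists_finite_coloring (h V hV)
  refine ⟨{t | ∀ x : X, (x, t • x) ∈ ε}, ?_, fun t ht => ht⟩
  choose r hr using fun k : Set.range c => k.2
  refine ⟨Set.range fun k => r k ^ n (r k), (Set.finite_range _).isCompact, fun t => ?_⟩
  refine ⟨_, ⟨⟨c t, t, rfl⟩, rfl⟩, fun x => ?_⟩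
  set s := r ⟨c t, t, rfl⟩
  have hst : c s = c t := hr _
  have h₁ := hn s x
  have h₂ := hc _ _ hst x (s ^ n s)
  rw [pow_succ, mul_smul] at h₁
  rw [mul_smul]
  exact hV4 _ _ _ _ _ (hVs _ _ h₁) h₂ (refl_mem_uniformity hV) (refl_mem_uniformity hV)

theorem eventually_forall_smul_mem {T X : Type*} [TopologicalSpace T] [UniformSpace X]
    [CompactSpace X] [SMul T X] [ContinuousSMul T X] {K : Set T} (hK : IsCompact K)
    {ε : Set (X × X)} (hε : ε ∈ 𝓤 X) : ∀ᶠ p : X × X in 𝓤 X, ∀ k ∈ K, (k • p.1, k • p.2) ∈ ε := by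
  refine compactSpace_mem_uniformity fun x => ?_
  refine hK.eventually_forall_of_forall_eventually fun k _ => ?_
  have : Continuous fun z : (X × X) × T => (z.2 • z.1.1, z.2 • z.1.2) := by fun_prop
  refine this.continuousAt.eventually (?_ : ε ∈ 𝓝 (k • x, k • x))
  exact nhds_prod_eq (x := k • x) (y := k • x) ▸ nhds_le_uniformity (k • x) hε

/-- Points identified by `t` are identified by `k * t`, which can be chosen to move every point
arbitrarily little. -/
theorem UniformlyAlmostPeriodic.smul_injective {T X : Type*} [Monoid T] [TopologicalSpace T]
    [UniformSpace X] [T2Space X] [MulAction T X] (h : UniformlyAlmostPeriodic T X) (t : T) :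
    Function.Injective fun x : X => t • x := by
  intro x y hxy
  refine eq_of_uniformity fun {ε} hε => ?_
  obtain ⟨V, hV, hVs, hV4⟩ := exists_symm_four_comp_subset hε
  obtain ⟨A, ⟨K, -, hKA⟩, hA⟩ := h V hV
  obtain ⟨k, -, hk⟩ := hKA t
  have h₁ := hA _ hk x
  rw [mul_smul, show t • x = t • y from hxy, ← mul_smul] at h₁
  exact hV4 _ _ _ _ _ h₁ (hVs _ _ (hA _ hk y)) (refl_mem_uniformity hV) (refl_mem_uniformity hV)

theorem UniformlyAlmostPeriodic.equicontinuous {T X : Type*} [Monoid T] [TopologicalSpace T]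
    [UniformSpace X] [CompactSpace X] [T2Space X] [MulAction T X] [ContinuousSMul T X]
    (h : UniformlyAlmostPeriodic T X)
    (hsurj : ∀ t : T, Function.Surjective fun x : X => t • x) : Equicontinuous T X := by
  let e : T → X ≃ X := fun t => Equiv.ofBijective (fun x => t • x) ⟨h.smul_injective t, hsurj t⟩
  have he : ∀ t x, e t x = t • x := fun _ _ => rfl
  have hinv : UniformEquicontinuous fun t => ((e t).symm : X → X) := by
    intro ε hε
    obtain ⟨V, hV, hVs, hV4⟩ := exists_symm_four_comp_subset hε
    obtain ⟨A, ⟨K, hK, hKA⟩, hA⟩ := h V hV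
    filter_upwards [eventually_forall_smul_mem hK hV] with ⟨x, y⟩ hxy t
    obtain ⟨k, hk, hkt⟩ := hKA t
    have key : ∀ z, ((e t).symm z, k • z) ∈ V := fun z => by
      have := hA _ hkt ((e t).symm z)
      rwa [mul_smul, ← he t, Equiv.apply_symm_apply] at this
    exact hV4 _ _ _ _ _ (key x) (hxy k hk) (hVs _ _ (key y)) (refl_mem_uniformity hV)
  rw [uniformEquicontinuous_iff]
  -- The family of inverses is closed under powers, so its own inverses, namely `T`, are
  -- equicontinuous.
  refine UniformEquicontinuous.symm_of_iterate (φ := fun t => (e t).symm) hinv fun t n =>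
    ⟨t ^ n, ?_⟩
  have h₁ : (e (t ^ n) : X → X) = (e t)^[n] := smul_iterate_eq t n
  funext x
  rw [Equiv.symm_apply_eq, h₁]
  exact (((e t).right_inv.iterate n) x).symm

end Semiflow

/-! ### Oscillation of separately continuous functions -/

/-- If `z` is in the closure of a sequence `x`, then a separately continuous function on `X × K`
at `z` is, up to `ε`, determined by its values at finitely many terms of the sequence. -/
theorem exists_forall_abs_sub_le_of_mem_closure_range {X K : Type*} [TopologicalSpace X]
    [TopologicalSpace K] [CompactSpace K] {F : X → K → ℝ} (hF₁ : ∀ k, Continuous fun x => F x k)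
    (hF₂ : ∀ x, Continuous (F x)) {x : ℕ → X} {z : X} (hz : z ∈ closure (Set.range x))
    {ε : ℝ} (hε : 0 < ε) : ∃ n : ℕ, ∀ k k', (∀ i < n, |F (x i) k - F (x i) k'| ≤ 1 / (n + 1)) →
      |F z k - F z k'| ≤ ε := by
  let O : ℕ → Set (K × K) := fun n => {p | ∃ i < n, 1 / ((n : ℝ) + 1) < |F (x i) p.1 - F (x i) p.2|}
  have hcont : ∀ y, Continuous fun p : K × K => |F y p.1 - F y p.2| := fun y =>
    (((hF₂ y).comp continuous_fst).sub ((hF₂ y).comp continuous_snd)).abs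
  have hO : ∀ n, IsOpen (O n) := fun n => by
    have : O n = ⋃ i < n, {p | 1 / ((n : ℝ) + 1) < |F (x i) p.1 - F (x i) p.2|} := by
      ext p; simp [O]
    rw [this]
    exact isOpen_biUnion fun i _ => isOpen_lt continuous_const (hcont (x i))
  have hmono : Monotone O := by
    rintro m n hmn p ⟨i, hi, hp⟩
    exact ⟨i, hi.trans_le hmn, (Nat.one_div_le_one_div hmn).trans_lt hp⟩
  have hC : IsCompact {p : K × K | ε ≤ |F z p.1 - F z p.2|} :=
    (isClosed_le continuous_const (hcont z)).isCompact
  -- A pair separated at `z` is separated at some term of the sequence, by continuity in the first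
  -- variable.
  have hCO : {p : K × K | ε ≤ |F z p.1 - F z p.2|} ⊆ ⋃ n, O n := by
    intro p hp
    have hop : IsOpen {y | 0 < |F y p.1 - F y p.2|} :=
      isOpen_lt continuous_const ((hF₁ p.1).sub (hF₁ p.2)).abs
    obtain ⟨_, hy, i, rfl⟩ := mem_closure_iff.1 hz _ hop (hε.trans_le hp)
    obtain ⟨m, hm⟩ := exists_nat_one_div_lt (show 0 < |F (x i) p.1 - F (x i) p.2| from hy)
    refine Set.mem_iUnion.2 ⟨max (i + 1) m, i, by simp, lt_of_le_of_lt ?_ hm⟩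
    gcongr
    simp
  obtain ⟨n, hn⟩ := hC.elim_directed_cover O hO hCO hmono.directed_le
  refine ⟨n, fun k k' h => ?_⟩
  by_contra! hlt
  obtain ⟨i, hi, hlt'⟩ := hn (show (k, k') ∈ {p : K × K | ε ≤ |F z p.1 - F z p.2|} from hlt.le)
  exact hlt'.not_ge (h i hi)

/-- The points of `X` at which a separately continuous function is determined up to `ε` by its
values on a finite set form a set without interior, if the function has large oscillation on each
open set. -/
theorem exists_mem_forall_lt_abs_sub {X K : Type*} [TopologicalSpace X]
    [TopologicalSpace K] [CompactSpace K] {F : X → K → ℝ} (hF₁ : ∀ k, Continuous fun x => F x k)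
    (hF₂ : ∀ x, Continuous (F x)) {ε : ℝ} (hε : 0 < ε)
    (hosc : ∀ V : Set X, IsOpen V → V.Nonempty → ∃ u ∈ V, ∃ v ∈ V, ∃ k, 4 * ε < |F u k - F v k|)
    (S : Set X) (hS : S.Finite) {δ : ℝ} (hδ : 0 < δ) {U : Set X} (hU : IsOpen U)
    (hne : U.Nonempty) :
    ∃ u ∈ U, ∃ k k', (∀ x ∈ S, |F x k - F x k'| ≤ δ) ∧ ε < |F u k - F u k'| := by
  by_contra! hcon
  obtain ⟨t, ht⟩ := isCompact_univ.elim_finite_subcover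
    (fun k₀ : K => {k | ∀ x ∈ S, |F x k - F x k₀| < δ})
    (fun k₀ => by
      simp only [Set.ofPred_forall]
      exact hS.isOpen_biInter fun x _ => isOpen_lt ((hF₂ x).sub continuous_const).abs
        continuous_const)
    (fun k _ => Set.mem_iUnion.2 ⟨k, fun x _ => by simpa using hδ⟩)
  obtain ⟨u₀, hu₀⟩ := hne
  -- On `V` the values at the finite net `t` stay within `ε` of those at `u₀`. Replacing `k` by its
  -- net point costs `ε` at each of `u` and `v`, for a total of `4 * ε`.
  let V : Set X := U ∩ ⋂ k ∈ t, {u | |F u k - F u₀ k| < ε}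
  have hV : IsOpen V := hU.inter <| isOpen_biInter_finset fun k _ =>
    isOpen_lt ((hF₁ k).sub continuous_const).abs continuous_const
  obtain ⟨u, hu, v, hv, k, hk⟩ := hosc V hV ⟨u₀, hu₀, by simpa using fun _ _ => hε⟩
  obtain ⟨j, hj, hkj⟩ := Set.mem_iUnion₂.1 (ht (Set.mem_univ k))
  have h₁ := abs_le.1 (hcon u hu.1 k j fun x hx => (hkj x hx).le)
  have h₂ := abs_le.1 (hcon v hv.1 k j fun x hx => (hkj x hx).le)
  have h₃ := abs_lt.1 (show |F u j - F u₀ j| < ε from Set.mem_iInter₂.1 hu.2 j hj)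
  have h₄ := abs_lt.1 (show |F v j - F u₀ j| < ε from Set.mem_iInter₂.1 hv.2 j hj)
  refine hk.not_ge (abs_le.2 ⟨?_, ?_⟩) <;> linarith [h₁.1, h₁.2, h₂.1, h₂.2, h₃.1, h₃.2, h₄.1, h₄.2]

/-- A separately continuous real function on a product of compact spaces has small oscillation,
uniformly in the second variable, on some nonempty open subset of the first factor. -/
theorem exists_isOpen_forall_abs_sub_le {X K : Type*} [TopologicalSpace X] [CompactSpace X]
    [T2Space X] [Nonempty X] [TopologicalSpace K] [CompactSpace K] {F : X → K → ℝ}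
    (hF₁ : ∀ k, Continuous fun x => F x k) (hF₂ : ∀ x, Continuous (F x)) {ε : ℝ} (hε : 0 < ε) :
    ∃ V : Set X, IsOpen V ∧ V.Nonempty ∧ ∀ u ∈ V, ∀ v ∈ V, ∀ k, |F u k - F v k| ≤ ε := by
  by_contra! hosc
  have hε4 : 0 < ε / 4 := by positivity
  let P := {U : Set X // IsOpen U ∧ U.Nonempty}
  -- Finiteness of `S` is placed after the existential so that `choose` gives a total `next`.
  have step : ∀ (S : Set X) (n : ℕ) (U : P), ∃ U' : P, S.Finite → closure U'.1 ⊆ U.1 ∧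
      ∀ u ∈ closure U'.1, ∃ k k', (∀ x ∈ S, |F x k - F x k'| ≤ 1 / ((n : ℝ) + 1)) ∧
        ε / 4 < |F u k - F u k'| := by
    intro S n U
    by_cases hS : S.Finite
    swap
    · exact ⟨U, fun h => absurd h hS⟩
    obtain ⟨u, hu, k, k', hkk, hlt⟩ := exists_mem_forall_lt_abs_sub hF₁ hF₂ hε4
      (fun V hV hne => by
        obtain ⟨u, hu, v, hv, k, h⟩ := hosc V hV hne
        exact ⟨u, hu, v, hv, k, by linarith⟩) S hS
      (Nat.one_div_pos_of_nat (α := ℝ) (n := n)) U.2.1 U.2.2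
    have hO : IsOpen (U.1 ∩ {u | ε / 4 < |F u k - F u k'|}) :=
      U.2.1.inter (isOpen_lt continuous_const ((hF₁ k).sub (hF₁ k')).abs)
    obtain ⟨C, hC, hCc, hCO⟩ := exists_mem_nhds_isClosed_subset (hO.mem_nhds ⟨hu, hlt⟩)
    have hcl : closure (interior C) ⊆ C := hCc.closure_interior_subset
    exact ⟨⟨interior C, isOpen_interior, u, mem_interior_iff_mem_nhds.2 hC⟩, fun _ =>
      ⟨fun v hv => (hCO (hcl hv)).1, fun v hv => ⟨k, k', hkk, (hCO (hcl hv)).2⟩⟩⟩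
  choose next hnext using step
  choose pt hpt using fun U : P => U.2.2
  let s : ℕ → Set X × P := fun n => n.rec (∅, ⟨Set.univ, isOpen_univ, Set.univ_nonempty⟩)
    fun n q => (insert (pt q.2) q.1, next q.1 n q.2)
  let x : ℕ → X := fun n => pt (s n).2
  have hfin : ∀ n, (s n).1.Finite := fun n => by
    induction n with
    | zero => exact Set.finite_empty
    | succ n ih => exact ih.insert _
  have hmem : ∀ n, ∀ i < n, x i ∈ (s n).1 := fun n => by
    induction n with
    | zero => simp
    | succ n ih =>
      intro i hi
      rcases Nat.lt_succ_iff_lt_or_eq.1 hi with hi | rfl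
      exacts [Set.mem_insert_of_mem _ (ih i hi), Set.mem_insert _ _]
  have hanti : Antitone fun n => (s n).2.1 :=
    antitone_nat_of_succ_le fun n => subset_closure.trans (hnext (s n).1 n (s n).2 (hfin n)).1
  have hmemC : ∀ n, ∀ i, n ≤ i → x i ∈ (s n).2.1 := fun n i hi => hanti hi (hpt _)
  -- The cluster point lies in every closure, so at each stage some pair nearly agrees on the
  -- earlier terms yet differs at `z`, contradicting finite determination.
  obtain ⟨z, hz⟩ : ∃ z, MapClusterPt z atTop x := exists_clusterPt_of_compactSpace _
  have hcl : ∀ {C : Set X}, IsClosed C → (∀ᶠ i in atTop, x i ∈ C) → z ∈ C := fun hC h =>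
    isClosed_iff_clusterPt.1 hC z (ClusterPt.mono hz (le_principal_iff.2 h))
  obtain ⟨n, hn⟩ := exists_forall_abs_sub_le_of_mem_closure_range hF₁ hF₂ (x := x) (z := z)
    (hcl isClosed_closure (Eventually.of_forall fun i => subset_closure ⟨i, rfl⟩)) hε4
  have hzn : z ∈ closure (s (n + 1)).2.1 := hcl isClosed_closure <|
    (eventually_ge_atTop (n + 1)).mono fun i hi => subset_closure (hmemC _ i hi)
  obtain ⟨k, k', hkk, hlt⟩ := (hnext (s n).1 n (s n).2 (hfin n)).2 z hzn
  exact hlt.not_ge (hn k k' fun i hi => hkk _ (hmem n i hi))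

/-! ### Weak almost periodicity and the Ellis semigroup -/

namespace Semiflow

section Equicontinuous

variable {T X : Type*} [Monoid T] [UniformSpace X] [CompactSpace X] [MulAction T X]
  [ContinuousConstSMul T X]

theorem Equicontinuous.weaklyAlmostPeriodic (h : Equicontinuous T X) :
    WeaklyAlmostPeriodic T X := by
  intro f
  rw [uniformEquicontinuous_iff] at h
  let A : Set (X → ℝ) := Subtype.val '' Set.range fun t : T => translate f t
  have hA : A.Equicontinuous := by
    have hf : UniformEquicontinuous fun (t : T) (x : X) => f.1 (t • x) := fun ε hε =>
      h _ (CompactSpace.uniformContinuous_of_continuous f.2 hε)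
    have hf' : A.UniformEquicontinuous := by
      intro ε hε
      filter_upwards [hf ε hε] with p hp
      rintro ⟨_, _, ⟨t, rfl⟩, rfl⟩
      exact hp t
    exact hf'.equicontinuous
  have hcpt : IsCompact (closure A) := by
    refine (isCompact_univ_pi fun _ : X => isCompact_range f.2).closure_of_subset ?_
    rintro _ ⟨_, ⟨t, rfl⟩, rfl⟩ x -
    exact ⟨t • x, rfl⟩
  have hval : IsInducing (Subtype.val : Cp X → X → ℝ) := .subtypeVal
  rw [hval.closure_eq_preimage_closure_image]
  refine hval.isCompact_preimage' hcpt fun g hg => ?_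
  exact ⟨⟨g, hA.closure.continuous ⟨g, hg⟩⟩, rfl⟩

end Equicontinuous

section Enveloping

variable (T X : Type*) [Monoid T] [TopologicalSpace X] [MulAction T X]

/-- The enveloping (Ellis) semigroup: the pointwise closure of `T` in `X → X`. -/
def envelope : Set (X → X) := closure (Set.range fun (t : T) (x : X) => t • x)

variable {T X}

theorem smul_mem_envelope (t : T) : (fun x : X => t • x) ∈ envelope T X :=
  subset_closure ⟨t, rfl⟩

theorem isCompact_envelope [CompactSpace X] : IsCompact (envelope T X) :=
  isClosed_closure.isCompact

theorem envelope_subset {C : Set (X → X)} (hC : IsClosed C) (h : ∀ t : T, (t • ·) ∈ C) :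
    envelope T X ⊆ C :=
  closure_minimal (Set.range_subset_iff.2 h) hC

theorem continuous_comp_right_pi (q : X → X) : Continuous fun p : X → X => p ∘ q :=
  continuous_pi fun x => continuous_apply (q x)

theorem comp_mem_envelope [ContinuousConstSMul T X] {p q : X → X} (hp : p ∈ envelope T X)
    (hq : q ∈ envelope T X) : p ∘ q ∈ envelope T X := by
  -- Precomposition by any `q` is continuous; postcomposition needs a continuous map, so `p` is
  -- reduced to some `t` first.
  refine envelope_subset (isClosed_closure.preimage (continuous_comp_right_pi q)) (fun t => ?_) hp
  refine envelope_subset (C := {q | (fun x => t • q x) ∈ envelope T X})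
    (isClosed_closure.preimage (by fun_prop)) (fun s => ?_) hq
  have := smul_mem_envelope (X := X) (t * s)
  simpa only [Set.mem_ofPred_eq, mul_smul] using this

theorem aut_comm_of_mem_envelope [T2Space X] {p : X → X} (hp : p ∈ envelope T X) {a : X ≃ₜ X}
    (ha : a ∈ aut T X) (x : X) : a (p x) = p (a x) :=
  envelope_subset (C := {p | a (p x) = p (a x)})
    (isClosed_eq (a.continuous.comp (continuous_apply x)) (continuous_apply (a x)))
    (fun t => ha t x) hp

theorem WeaklyAlmostPeriodic.continuous_of_mem_envelope [CompletelyRegularSpace X]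
    [ContinuousConstSMul T X] (h : WeaklyAlmostPeriodic T X) {p : X → X}
    (hp : p ∈ envelope T X) : Continuous p := by
  have key : ∀ f : X → ℝ, Continuous f → Continuous (f ∘ p) := fun f hf => by
    -- Compactness in `Cp X` makes the closure of the translates closed in all of `X → ℝ`, so
    -- pointwise limits remain continuous.
    have hC := ((h ⟨f, hf⟩).image continuous_subtype_val).isClosed
    have hfp : Continuous fun q : X → X => f ∘ q :=
      continuous_pi fun x => hf.comp (continuous_apply x)
    obtain ⟨g, -, hg⟩ := envelope_subset (hC.preimage hfp)
      (fun t => ⟨translate ⟨f, hf⟩ t, subset_closure ⟨t, rfl⟩, rfl⟩) hp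
    rw [← show g.1 = f ∘ p from hg]
    exact g.2
  refine continuous_iff_continuousAt.2 fun x => fun V hV => ?_
  obtain ⟨f, hf, hfx, hfV⟩ := CompletelyRegularSpace.completely_regular (p x) (interior V)ᶜ
    isOpen_interior.isClosed_compl (fun hn => hn (mem_interior_iff_mem_nhds.2 hV))
  have hc := key (fun y => (f y : ℝ)) (continuous_subtype_val.comp hf)
  have hmem : ∀ᶠ y in 𝓝 x, (f (p y) : ℝ) < 1 :=
    hc.continuousAt.eventually_lt continuousAt_const (by simp [hfx])
  refine mem_map.2 ?_
  filter_upwards [hmem] with y hy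
  by_contra hyV
  have : f (p y) = 1 := hfV fun hi => hyV (show p y ∈ V from interior_subset hi)
  simp [this] at hy

/-- If every member of the enveloping semigroup is surjective, then the enveloping semigroup is a
group. -/
theorem exists_left_inverse_mem_envelope [CompactSpace X] [T2Space X] [ContinuousConstSMul T X]
    (hsurj : ∀ p ∈ envelope T X, Function.Surjective p) {p : X → X} (hp : p ∈ envelope T X) :
    ∃ q ∈ envelope T X, q ∘ p = id := by
  let : Semigroup (X → X) := { mul := fun p q => p ∘ q, mul_assoc := fun _ _ _ => rfl }
  obtain ⟨_, ⟨q, hq, rfl⟩, he⟩ := exists_idempotent_in_compact_subsemigroup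
    (M := X → X) continuous_comp_right_pi ((fun q => q ∘ p) '' envelope T X) ⟨_, p, hp, rfl⟩
    (isCompact_envelope.image (continuous_comp_right_pi p)) (by
      rintro _ ⟨a, ha, rfl⟩ _ ⟨b, hb, rfl⟩
      exact ⟨(a ∘ p) ∘ b, comp_mem_envelope (comp_mem_envelope ha hp) hb, rfl⟩)
  -- A surjective idempotent is the identity.
  refine ⟨q, hq, funext fun x => ?_⟩
  obtain ⟨y, rfl⟩ := hsurj _ (comp_mem_envelope hq hp) x
  exact congrFun he y

end Enveloping

/-- By compactness of the complement of an open entourage, finitely many real functions detect all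
pairs outside it. -/
theorem equicontinuous_of_forall_real {T X : Type*} [Monoid T] [UniformSpace X] [CompactSpace X]
    [T2Space X] [MulAction T X]
    (h : ∀ f : X → ℝ, Continuous f → ∀ η : ℝ, 0 < η → ∀ x : X, ∃ V ∈ 𝓝 x, ∀ y ∈ V, ∀ z ∈ V,
      ∀ t : T, |f (t • y) - f (t • z)| ≤ η) : Equicontinuous T X := by
  intro ε hε
  refine ⟨{p | ∀ t : T, (t • p.1, t • p.2) ∈ ε}, ?_, fun x y hxy => hxy⟩
  obtain ⟨U, hU, hUo, hUε⟩ : ∃ U ∈ 𝓤 X, IsOpen U ∧ U ⊆ ε :=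
    ⟨interior ε, interior_mem_uniformity hε, isOpen_interior, interior_subset⟩
  obtain ⟨F, hF⟩ := hUo.isClosed_compl.isCompact.elim_finite_subcover
    (fun fη : {fη : (X → ℝ) × ℝ // Continuous fη.1 ∧ 0 < fη.2} =>
      {p : X × X | fη.1.2 < |fη.1.1 p.1 - fη.1.1 p.2|})
    (fun fη => isOpen_lt continuous_const
      ((fη.2.1.comp continuous_fst).sub (fη.2.1.comp continuous_snd)).abs) (by
      rintro ⟨x, y⟩ hxy
      have hne : x ≠ y := by rintro rfl; exact hxy (refl_mem_uniformity hU)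
      obtain ⟨f, hf, hfx, hfy⟩ := CompletelyRegularSpace.completely_regular x {y}
        isClosed_singleton hne
      refine Set.mem_iUnion.2 ⟨⟨(fun y => (f y : ℝ), 1 / 2),
        continuous_subtype_val.comp hf, by norm_num⟩, ?_⟩
      have : f y = 1 := hfy rfl
      simp only [Set.mem_ofPred_eq, hfx, this]
      norm_num)
  refine compactSpace_mem_uniformity fun x => ?_
  have : ∀ fη ∈ F, ∀ᶠ p : X × X in 𝓝 (x, x), ∀ t : T,
      |fη.1.1 (t • p.1) - fη.1.1 (t • p.2)| ≤ fη.1.2 := fun fη _ => by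
    obtain ⟨V, hV, hVt⟩ := h fη.1.1 fη.2.1 fη.1.2 fη.2.2 x
    filter_upwards [prod_mem_nhds hV hV] with p hp t using hVt _ hp.1 _ hp.2 t
  filter_upwards [(Filter.eventually_all_finset F).2 this] with p hp t
  by_contra hpt
  obtain ⟨fη, hfη, hlt⟩ := Set.mem_iUnion₂.1 (hF fun hn => hpt (hUε hn))
  exact (hp fη hfη t).not_gt hlt

theorem WeaklyAlmostPeriodic.equicontinuous {T X : Type*} [Monoid T] [UniformSpace X]
    [CompactSpace X] [T2Space X] [MulAction T X] [ContinuousConstSMul T X]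
    [MulAction.IsMinimal T X] (h : WeaklyAlmostPeriodic T X)
    (htrans : UniversallyTransitive T X) : Equicontinuous T X := by
  refine equicontinuous_of_forall_real fun f hf η hη x => ?_
  have : Nonempty X := ⟨x⟩
  have : CompactSpace (envelope T X) := isCompact_iff_compactSpace.1 isCompact_envelope
  obtain ⟨V, hV, hne, hVη⟩ := exists_isOpen_forall_abs_sub_le
    (F := fun (y : X) (p : envelope T X) => f (p.1 y))
    (fun p => hf.comp (h.continuous_of_mem_envelope p.2))
    (fun y => hf.comp ((continuous_apply y).comp continuous_subtype_val)) hη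
  obtain ⟨t, ht⟩ := hV.exists_smul_mem T x hne
  obtain ⟨q, hq, hqt⟩ := exists_left_inverse_mem_envelope
    (fun p hp => htrans.surjective fun a ha => aut_comm_of_mem_envelope hp ha)
    (smul_mem_envelope (X := X) t)
  refine ⟨(t • ·) ⁻¹' V, (hV.preimage (continuous_const_smul t)).mem_nhds ht,
    fun y hy z hz s => ?_⟩
  -- Since `q` inverts `t`, the map `s ∘ q` sends `t • y` to `s • y`.
  have key := hVη _ hy _ hz ⟨_, comp_mem_envelope (smul_mem_envelope s) hq⟩
  have hq' : ∀ y, q (t • y) = y := congrFun hqt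
  simpa only [Function.comp_apply, hq'] using key

end Semiflow

/-- `T` is a set of self-maps of `X` containing the identity and closed under composition, with
any topology for which `(T, X)` is a semiflow; by `ContinuousSMul` each `t ∈ T` is continuous. -/
theorem mainTheorem7 {X : Type*} [UniformSpace X] [CompactSpace X] [T2Space X]
    (T : Submonoid (Function.End X)) [TopologicalSpace T] [ContinuousMul T] [ContinuousSMul T X]
    (hmin : MulAction.IsMinimal T X) (htrans : Semiflow.UniversallyTransitive T X) :
    (Semiflow.WeaklyAlmostPeriodic T X ↔ Semiflow.Equicontinuous T X) ∧
      (Semiflow.Equicontinuous T X ↔ Semiflow.UniformlyAlmostPeriodic T X) := by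
  have hsurj := htrans.smul_surjective
  exact ⟨⟨fun h => h.equicontinuous htrans, fun h => h.weaklyAlmostPeriodic⟩,
    ⟨fun h => h.uniformlyAlmostPeriodic hsurj, fun h => h.equicontinuous hsurj⟩⟩
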